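/- Let $\mathcal S(\mathbb R)$ be the Schwartz space of real-valued functions on $\mathbb R$, and let $\mathcal S'(\mathbb R)$ be the space of real tempered distributions with its cylindrical $\sigma$-algebra. Let $\mu$ be the white noise measure on $\mathcal S'(\mathbb R)$, i.e. the measure with $$\int_{\mathcal S'(\mathbb R)} e^{i\langle\omega,\xi\rangle}\,d\mu(\omega)=\exp\Big(-\tfrac12\int_{\mathbb R}\xi(x)^2\,dx\Big),\qquad \xi\in\mathcal S(\mathbb R).$$ For $f\in L^2(\mathbb R)$ let $\langle\cdot,f\rangle\in L^2(\mu)$ be the $L^2(\mu)$-limit of $\langle\cdot,\xi_n\rangle$ for Schwartz functions $\xi_n\to f$ in $L^2(\mathbb R)$. Let $0<T<\infty$ and $a,b\in\mathbb R$. Let $(B_t)_{0\le t\le T}$ be a modification of $(\langle\cdot,\mathbf 1_{[0,t)}\rangle)_{0\le t\le T}$ with almost surely continuous paths (a standard Brownian motion), and let $$X_t=a\Big(1-\frac tT\Big)+b\,\frac tT+B_t-\frac tT B_T,\qquad 0\le t\le T,$$ be the Brownian bridge from $a$ to $b$ on $[0,T]$. For $\varepsilon>0$ put $$\mathcal I_\varepsilon^{BB}=\int_0^T\int_0^t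 p_\varepsilon(X_t-X_s)\,ds\,dt,\qquad p_\varepsilon(x)=\frac1{\sqrt{2\pi\varepsilon}}\,e^{-x^2/(2\varepsilon)}.$$ Then $\mathcal I_\varepsilon^{BB}\in L^2(\mu)$ for every $\varepsilon>0$, and the limit $\mathcal I^{BB}:=\lim_{\varepsilon\downarrow0}\mathcal I^{BB}_\varepsilon$ exists in $L^2(\mu)$ (this limit is the self-intersection local time of $X$). Moreover, for every $z\in\mathbb C$ with $\operatorname{Re}z\le0$ and every $1\le p<\infty$, the functions $\exp(z\,\mathcal I^{BB}_\varepsilon)$, $\varepsilon>0$, and $\exp(z\,\mathcal I^{BB})$ belong to $L^p(\mu)$, and $$\lim_{\varepsilon\downarrow0}\big\|\exp(z\,\mathcal I^{BB}_\varepsilon)-\exp(z\,\mathcal I^{BB})\big\|_{L^p(\mu)}=0.$$ -/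

import Mathlib

open MeasureTheory Filter Topology Set
open scoped SchwartzMap ENNReal

/-- The space `S'(ℝ)` of real tempered distributions on the line: the continuous linear
functionals on the Schwartz space of real-valued functions. -/
abbrev RealTemperedDual : Type := 𝓢(ℝ, ℝ) →L[ℝ] ℝ

/-- The cylindrical `σ`-algebra on `S'(ℝ)`: the smallest one that makes every evaluation
`ω ↦ ⟨ω, ξ⟩`, `ξ ∈ S(ℝ)`, measurable. -/
noncomputable instance RealTemperedDual.cylindrical : MeasurableSpace RealTemperedDual :=
  ⨆ ξ : 𝓢(ℝ, ℝ), MeasurableSpace.comap (fun ω : RealTemperedDual => ω ξ) (borel ℝ)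

/-- `μ` is the white noise measure on `S'(ℝ)`, i.e. the (unique) measure on the cylindrical
`σ`-algebra with characteristic function `ξ ↦ exp (-|ξ|² / 2)`, where `|·|` is the norm of
`L²(ℝ)`. Taking `ξ = 0` shows that it is a probability measure. -/
def IsWhiteNoiseMeasure (μ : Measure RealTemperedDual) : Prop :=
  ∀ ξ : 𝓢(ℝ, ℝ),
    ∫ ω : RealTemperedDual, Complex.exp (Complex.I * ((ω ξ : ℝ) : ℂ)) ∂μ
      = Complex.exp (((-(1 / 2) * ∫ x : ℝ, ξ x ^ 2 : ℝ) : ℂ))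

/-- `Y` is a version of the random variable `⟨·, f⟩ ∈ L²(μ)` for `f ∈ L²(ℝ)`: the `L²(μ)`-limit
of `⟨·, ξ n⟩` along all sequences `ξ n` of Schwartz functions that converge to `f` in `L²(ℝ)`. -/
def IsWhiteNoisePairing (μ : Measure RealTemperedDual) (f : ℝ → ℝ)
    (Y : RealTemperedDual → ℝ) : Prop :=
  MemLp f 2 volume ∧ MemLp Y 2 μ ∧
    ∀ ξ : ℕ → 𝓢(ℝ, ℝ),
      Tendsto (fun n => eLpNorm (fun x => ξ n x - f x) 2 volume) atTop (𝓝 0) →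
      Tendsto (fun n => eLpNorm (fun ω : RealTemperedDual => ω (ξ n) - Y ω) 2 μ) atTop (𝓝 0)

/-- `B` is a continuous modification of `(⟨·, 1_[0,t)⟩)_{0 ≤ t ≤ T}`, i.e. a standard Brownian
motion on `[0, T]` realized on the white noise space. -/
structure IsWhiteNoiseBrownianMotion (μ : Measure RealTemperedDual) (T : ℝ)
    (B : ℝ → RealTemperedDual → ℝ) : Prop where
  pairing : ∀ t ∈ Icc 0 T, IsWhiteNoisePairing μ ((Ico 0 t).indicator fun _ => (1 : ℝ)) (B t)
  continuous_paths : ∀ᵐ ω ∂μ, ContinuousOn (fun t => B t ω) (Icc 0 T)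

/-- The Brownian bridge from `a` to `b` on `[0, T]` built from the Brownian motion `B`. -/
noncomputable def brownianBridge (a b T : ℝ) (B : ℝ → RealTemperedDual → ℝ) (t : ℝ)
    (ω : RealTemperedDual) : ℝ :=
  a * (1 - t / T) + b * (t / T) + B t ω - t / T * B T ω

/-- The heat kernel `p_ε`. -/
noncomputable def heatKernelReal (ε x : ℝ) : ℝ :=
  1 / √(2 * Real.pi * ε) * Real.exp (-(x ^ 2) / (2 * ε))

/-- The approximated self-intersection local time
`∫_0^T ∫_0^t p_ε (X_t - X_s) ds dt` of a process `X` on `[0, T]`. -/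
noncomputable def approxSILT (T : ℝ) (X : ℝ → RealTemperedDual → ℝ) (ε : ℝ)
    (ω : RealTemperedDual) : ℝ :=
  ∫ t in (0 : ℝ)..T, ∫ s in (0 : ℝ)..t, heatKernelReal ε (X t ω - X s ω)

/-- `J` is (a version of) the self-intersection local time of `X` on `[0, T]`: the limit in
`L²(μ)` of the approximated self-intersection local times as `ε ↓ 0`. -/
structure IsSILT (μ : Measure RealTemperedDual) (T : ℝ) (X : ℝ → RealTemperedDual → ℝ)
    (J : RealTemperedDual → ℝ) : Prop where
  memLp_approx : ∀ ε : ℝ, 0 < ε → MemLp (approxSILT T X ε) 2 μ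
  memLp : MemLp J 2 μ
  tendsto : Tendsto (fun ε : ℝ => eLpNorm (fun ω => approxSILT T X ε ω - J ω) 2 μ)
    (𝓝[>] 0) (𝓝 0)

theorem IsWhiteNoiseMeasure.isProbabilityMeasure {μ : Measure RealTemperedDual}
    (hμ : IsWhiteNoiseMeasure μ) : IsProbabilityMeasure μ := by
  have h := hμ 0
  simp only [ContinuousLinearMap.map_zero, zero_apply] at h
  simp only [Complex.ofReal_zero, mul_zero, Complex.exp_zero, integral_const, ne_eq,
    OfNat.ofNat_ne_zero, not_false_eq_true, zero_pow] at h
  have h1 : μ.real univ = 1 := by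
    have : ((μ.real univ : ℝ) : ℂ) = 1 := by simpa using h
    exact_mod_cast this
  constructor
  rw [Measure.real] at h1
  rw [← ENNReal.ofReal_toReal (a := μ univ) (fun hh => by simp [hh] at h1), h1, ENNReal.ofReal_one]

theorem RealTemperedDual.measurable_eval (ξ : 𝓢(ℝ, ℝ)) :
    Measurable (fun ω : RealTemperedDual => ω ξ) := by
  have h : Measurable[MeasurableSpace.comap (fun ω : RealTemperedDual => ω ξ) (borel ℝ)]
      (fun ω : RealTemperedDual => ω ξ) := by
    rw [BorelSpace.measurable_eq (α := ℝ)]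
    exact comap_measurable _
  exact h.mono (le_iSup (fun ξ : 𝓢(ℝ, ℝ) =>
    MeasurableSpace.comap (fun ω : RealTemperedDual => ω ξ) (borel ℝ)) ξ) le_rfl

/-- `Y` is the `L²(μ)`-limit of `⟨·, ξ n⟩` for some sequence of Schwartz functions converging to
`f` in `L²(ℝ)`. -/
def IsSchwartzLimit (μ : Measure RealTemperedDual) (f : ℝ → ℝ)
    (Y : RealTemperedDual → ℝ) : Prop :=
  MemLp f 2 volume ∧ MemLp Y 2 μ ∧
    ∃ ξ : ℕ → 𝓢(ℝ, ℝ),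
      Tendsto (fun n => eLpNorm (fun x => ξ n x - f x) 2 volume) atTop (𝓝 0) ∧
      Tendsto (fun n => eLpNorm (fun ω : RealTemperedDual => ω (ξ n) - Y ω) 2 μ) atTop (𝓝 0)

theorem exists_seq_schwartz_tendsto {f : ℝ → ℝ} (hf : MemLp f 2 volume) :
    ∃ ξ : ℕ → 𝓢(ℝ, ℝ),
      Tendsto (fun n => eLpNorm (fun x => ξ n x - f x) 2 volume) atTop (𝓝 0) := by
  have hd := SchwartzMap.denseRange_toLpCLM (E := ℝ) (F := ℝ) (p := 2) (by simp)
    (μ := (volume : Measure ℝ))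
  have hm := hd (hf.toLp f)
  rw [mem_closure_iff_seq_limit] at hm
  obtain ⟨u, hu, hlim⟩ := hm
  choose ξ hξ using hu
  refine ⟨ξ, ?_⟩
  rw [Lp.tendsto_Lp_iff_tendsto_eLpNorm'] at hlim
  refine hlim.congr fun n => ?_
  refine eLpNorm_congr_ae ?_
  have h1 : (u n : ℝ → ℝ) =ᵐ[volume] ξ n := by
    rw [← hξ n]; exact SchwartzMap.coeFn_toLp _ _ _
  filter_upwards [h1, hf.coeFn_toLp] with x h1 h2
  simp [h1, h2]

theorem IsWhiteNoisePairing.isSchwartzLimit {μ : Measure RealTemperedDual} {f : ℝ → ℝ}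
    {Y : RealTemperedDual → ℝ} (h : IsWhiteNoisePairing μ f Y) : IsSchwartzLimit μ f Y := by
  obtain ⟨ξ, hξ⟩ := exists_seq_schwartz_tendsto h.1
  exact ⟨h.1, h.2.1, ξ, hξ, h.2.2 ξ hξ⟩

theorem tendsto_eLpNorm_two_sum_smul {α ι : Type*} [MeasurableSpace α] {ν : Measure α}
    (s : Finset ι) (c : ι → ℝ) {F : ι → ℕ → α → ℝ}
    (hF : ∀ i n, AEStronglyMeasurable (F i n) ν)
    (h : ∀ i, Tendsto (fun n => eLpNorm (F i n) 2 ν) atTop (𝓝 0)) :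
    Tendsto (fun n => eLpNorm (fun x => ∑ i ∈ s, c i * F i n x) 2 ν) atTop (𝓝 0) := by
  have hb : Tendsto (fun n => ∑ i ∈ s, ‖c i‖ₑ * eLpNorm (F i n) 2 ν) atTop (𝓝 0) := by
    have := tendsto_finsetSum s (fun i _ =>
      ENNReal.Tendsto.const_mul (a := ‖c i‖ₑ) (h i) (Or.inr (by simp)))
    simpa using this
  refine tendsto_of_tendsto_of_tendsto_of_le_of_le tendsto_const_nhds hb (fun _ => zero_le)
    fun n => ?_
  have h1 : (fun x => ∑ i ∈ s, c i * F i n x) = ∑ i ∈ s, c i • F i n := by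
    ext x; simp
  rw [h1]
  refine (eLpNorm_sum_le (fun i _ => (hF i n).const_smul _) (by norm_num)).trans ?_
  exact Finset.sum_le_sum fun i _ => (eLpNorm_const_smul_le)

theorem IsSchwartzLimit.sum_smul {μ : Measure RealTemperedDual} {ι : Type*} (s : Finset ι)
    (c : ι → ℝ) {f : ι → ℝ → ℝ} {Y : ι → RealTemperedDual → ℝ}
    (h : ∀ i, IsSchwartzLimit μ (f i) (Y i)) :
    IsSchwartzLimit μ (fun x => ∑ i ∈ s, c i * f i x) (fun ω => ∑ i ∈ s, c i * Y i ω) := by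
  choose h1 h2 ξ h3 h4 using h
  refine ⟨memLp_finsetSum s fun i _ => (h1 i).const_mul _,
    memLp_finsetSum s fun i _ => (h2 i).const_mul _,
    fun n => ∑ i ∈ s, c i • ξ i n, ?_, ?_⟩
  · have := tendsto_eLpNorm_two_sum_smul s c (fun i n =>
      ((ξ i n).memLp 2 volume).1.sub (h1 i).1) h3
    refine this.congr fun n => ?_
    congr 1
    ext x
    simp [mul_sub]
  · have := tendsto_eLpNorm_two_sum_smul s c (fun i n =>
      (RealTemperedDual.measurable_eval (ξ i n)).aestronglyMeasurable.sub (h2 i).1) h4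
    refine this.congr fun n => ?_
    congr 1
    ext x
    simp [mul_sub]

theorem tendsto_integral_sq_of_tendsto_eLpNorm {α : Type*} [MeasurableSpace α] {ν : Measure α}
    {f : α → ℝ} {g : ℕ → α → ℝ} (hf : MemLp f 2 ν) (hg : ∀ n, MemLp (g n) 2 ν)
    (h : Tendsto (fun n => eLpNorm (fun x => g n x - f x) 2 ν) atTop (𝓝 0)) :
    Tendsto (fun n => ∫ x, g n x ^ 2 ∂ν) atTop (𝓝 (∫ x, f x ^ 2 ∂ν)) := by
  have key : ∀ u : α → ℝ, ∀ hu : MemLp u 2 ν, ‖hu.toLp u‖ ^ 2 = ∫ x, u x ^ 2 ∂ν := by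
    intro u hu
    rw [← real_inner_self_eq_norm_sq, L2.inner_def]
    refine integral_congr_ae ?_
    filter_upwards [hu.coeFn_toLp] with x hx
    simp [hx, sq]
  have h1 : Tendsto (fun n => (hg n).toLp (g n)) atTop (𝓝 (hf.toLp f)) := by
    rw [Lp.tendsto_Lp_iff_tendsto_eLpNorm'']
    exact h
  have h2 := (h1.norm).pow 2
  rw [key f hf] at h2
  exact h2.congr fun n => key _ (hg n)

theorem Real.norm_exp_I_mul_sub_exp_I_mul_le (x y : ℝ) :
    ‖Complex.exp (Complex.I * x) - Complex.exp (Complex.I * y)‖ ≤ ‖x - y‖ := by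
  have : Complex.exp (Complex.I * x) - Complex.exp (Complex.I * y)
      = Complex.exp (Complex.I * y) * (Complex.exp (Complex.I * ((x - y : ℝ) : ℂ)) - 1) := by
    rw [mul_sub, ← Complex.exp_add]; push_cast; ring_nf
  rw [this, norm_mul, mul_comm Complex.I, Complex.norm_exp_ofReal_mul_I, one_mul]
  exact Real.norm_exp_I_mul_ofReal_sub_one_le

theorem IsSchwartzLimit.integral_exp {μ : Measure RealTemperedDual} (hμ : IsWhiteNoiseMeasure μ)
    {f : ℝ → ℝ} {Y : RealTemperedDual → ℝ} (h : IsSchwartzLimit μ f Y) :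
    ∫ ω, Complex.exp (Complex.I * ((Y ω : ℝ) : ℂ)) ∂μ
      = Complex.exp (((-(1 / 2) * ∫ x : ℝ, f x ^ 2 : ℝ) : ℂ)) := by
  have := hμ.isProbabilityMeasure
  obtain ⟨hf, hY, ξ, h1, h2⟩ := h
  have m : ∀ {Z : RealTemperedDual → ℝ}, AEStronglyMeasurable Z μ →
      AEStronglyMeasurable (fun ω => Complex.exp (Complex.I * ((Z ω : ℝ) : ℂ))) μ := fun hZ =>
    (by fun_prop : Continuous fun x : ℝ => Complex.exp (Complex.I * (x : ℂ))).comp_aestronglyMeasurable hZ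
  have int : ∀ {Z : RealTemperedDual → ℝ}, AEStronglyMeasurable Z μ →
      Integrable (fun ω => Complex.exp (Complex.I * ((Z ω : ℝ) : ℂ))) μ := fun hZ =>
    Integrable.of_bound (m hZ) 1 (ae_of_all _ fun ω => by
      rw [mul_comm, Complex.norm_exp_ofReal_mul_I])
  have me : ∀ n, AEStronglyMeasurable (fun ω : RealTemperedDual => ω (ξ n)) μ := fun n =>
    (RealTemperedDual.measurable_eval (ξ n)).aestronglyMeasurable
  have t1 : Tendsto (fun n => ∫ ω, Complex.exp (Complex.I * ((ω (ξ n) : ℝ) : ℂ)) ∂μ) atTop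
      (𝓝 (∫ ω, Complex.exp (Complex.I * ((Y ω : ℝ) : ℂ)) ∂μ)) := by
    refine tendsto_integral_of_L1' _ (m hY.1)
      (Eventually.of_forall fun n => int (me n)) ?_
    refine tendsto_of_tendsto_of_tendsto_of_le_of_le tendsto_const_nhds h2 (fun _ => zero_le)
      fun n => ?_
    refine (eLpNorm_le_eLpNorm_of_exponent_le (by norm_num : (1 : ℝ≥0∞) ≤ 2)
      ((m (me n)).sub (m hY.1))).trans ?_
    exact eLpNorm_mono fun ω => Real.norm_exp_I_mul_sub_exp_I_mul_le _ _
  have t2 : Tendsto (fun n => Complex.exp (((-(1 / 2) * ∫ x : ℝ, ξ n x ^ 2 : ℝ) : ℂ))) atTop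
      (𝓝 (Complex.exp (((-(1 / 2) * ∫ x : ℝ, f x ^ 2 : ℝ) : ℂ)))) := by
    have := tendsto_integral_sq_of_tendsto_eLpNorm hf (fun n => (ξ n).memLp 2 volume) h1
    refine (Complex.continuous_exp.tendsto _).comp ?_
    exact (Complex.continuous_ofReal.tendsto _).comp (this.const_mul _)
  refine tendsto_nhds_unique t1 (t2.congr fun n => (hμ (ξ n)).symm)

/-- The Gram matrix of the indicators `1_[0,t)` is `min s t`. -/
theorem integral_sum_indicator_sq {ι : Type*} (s : Finset ι) (c t : ι → ℝ) (ht : ∀ i, 0 ≤ t i) :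
    ∫ x, (∑ i ∈ s, c i * (Ico 0 (t i)).indicator (fun _ => (1 : ℝ)) x) ^ 2
      = ∑ i ∈ s, ∑ j ∈ s, c i * c j * min (t i) (t j) := by
  have h1 : ∀ x, (∑ i ∈ s, c i * (Ico 0 (t i)).indicator (fun _ => (1 : ℝ)) x) ^ 2
      = ∑ i ∈ s, ∑ j ∈ s, c i * c j * (Ico 0 (min (t i) (t j))).indicator (fun _ => (1 : ℝ)) x := by
    intro x
    rw [sq, Finset.sum_mul_sum]
    refine Finset.sum_congr rfl fun i _ => Finset.sum_congr rfl fun j _ => ?_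
    rw [mul_mul_mul_comm, ← inter_indicator_mul, Ico_inter_Ico]
    simp
  have h2 : ∀ r : ℝ, Integrable ((Ico 0 r).indicator (fun _ => (1 : ℝ))) := fun r =>
    (integrable_indicator_iff measurableSet_Ico).2 (integrableOn_const (by simp))
  simp_rw [h1]
  rw [integral_finsetSum _ fun i _ => integrable_finsetSum _ fun j _ => (h2 _).const_mul _]
  refine Finset.sum_congr rfl fun i _ => ?_
  rw [integral_finsetSum _ fun j _ => (h2 _).const_mul _]
  refine Finset.sum_congr rfl fun j _ => ?_
  rw [integral_const_mul, integral_indicator measurableSet_Ico]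
  simp [ht i, ht j]

/-- The sum of the increments of a Brownian motion over `[s₁, t₁]` and `[s₂, t₂]` has variance
`|t₁-s₁| + |t₂-s₂| + |t₁-s₂| + |t₂-s₁| - |t₁-t₂| - |s₁-s₂|`. -/
def incrementVar (t₁ s₁ t₂ s₂ : ℝ) : ℝ :=
  |t₁ - s₁| + |t₂ - s₂| + |t₁ - s₂| + |t₂ - s₁| - |t₁ - t₂| - |s₁ - s₂|

theorem abs_sum_le_incrementVar (t₁ s₁ t₂ s₂ : ℝ) :
    |t₁ - s₁ + (t₂ - s₂)| ≤ incrementVar t₁ s₁ t₂ s₂ := by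
  unfold incrementVar
  rcases abs_cases (t₁ - s₁) with h1 | h1 <;> rcases abs_cases (t₂ - s₂) with h2 | h2 <;>
  rcases abs_cases (t₁ - s₂) with h3 | h3 <;> rcases abs_cases (t₂ - s₁) with h4 | h4 <;>
  rcases abs_cases (t₁ - t₂) with h5 | h5 <;> rcases abs_cases (s₁ - s₂) with h6 | h6 <;>
  exact abs_le.2 ⟨by linarith, by linarith⟩

theorem min_pairing_le_incrementVar (t₁ s₁ t₂ s₂ : ℝ) :
    |t₁ - s₁| + |t₂ - s₂| ≤ incrementVar t₁ s₁ t₂ s₂ ∨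
    |t₁ - s₂| + |t₂ - s₁| ≤ incrementVar t₁ s₁ t₂ s₂ ∨
    |t₁ - t₂| + |s₁ - s₂| ≤ incrementVar t₁ s₁ t₂ s₂ := by
  unfold incrementVar
  by_contra! hc
  obtain ⟨a, b, c⟩ := hc
  rcases abs_cases (t₁ - s₁) with h1 | h1 <;> rcases abs_cases (t₂ - s₂) with h2 | h2 <;>
  rcases abs_cases (t₁ - s₂) with h3 | h3 <;> rcases abs_cases (t₂ - s₁) with h4 | h4 <;>
  rcases abs_cases (t₁ - t₂) with h5 | h5 <;> rcases abs_cases (s₁ - s₂) with h6 | h6 <;>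
  linarith

theorem incrementVar_nonneg (t₁ s₁ t₂ s₂ : ℝ) : 0 ≤ incrementVar t₁ s₁ t₂ s₂ :=
  (abs_nonneg _).trans (abs_sum_le_incrementVar t₁ s₁ t₂ s₂)

theorem brownianBridge_norm_integral_exp_le {μ : Measure RealTemperedDual}
    (hμ : IsWhiteNoiseMeasure μ) {T : ℝ} (hT : 0 < T) {B : ℝ → RealTemperedDual → ℝ}
    (hB : IsWhiteNoiseBrownianMotion μ T B) (a b l : ℝ) {c d : ℝ} (hc : 0 ≤ c) (hd : d ≤ T)
    (hcd : d - c ≤ T / 4) {t₁ s₁ t₂ s₂ : ℝ} (ht₁ : t₁ ∈ Icc c d) (hs₁ : s₁ ∈ Icc c d)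
    (ht₂ : t₂ ∈ Icc c d) (hs₂ : s₂ ∈ Icc c d) :
    ‖∫ ω, Complex.exp (Complex.I * ((l * (brownianBridge a b T B t₁ ω
      - brownianBridge a b T B s₁ ω + (brownianBridge a b T B t₂ ω
      - brownianBridge a b T B s₂ ω)) : ℝ) : ℂ)) ∂μ‖
      ≤ Real.exp (-(l ^ 2 / 4 * incrementVar t₁ s₁ t₂ s₂)) := by
  set g : ℝ := t₁ - s₁ + (t₂ - s₂) with hg
  set t : Fin 5 → ℝ := ![t₁, s₁, t₂, s₂, T] with ht
  set k : Fin 5 → ℝ := ![l, -l, l, -l, -(l * (g / T))] with hk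
  have hsub : ∀ x ∈ Icc c d, x ∈ Icc 0 T := fun x hx => ⟨hc.trans hx.1, hx.2.trans hd⟩
  have hmem : ∀ i, t i ∈ Icc 0 T := by
    intro i
    fin_cases i
    exacts [hsub _ ht₁, hsub _ hs₁, hsub _ ht₂, hsub _ hs₂, ⟨hT.le, le_rfl⟩]
  have hlim := IsSchwartzLimit.sum_smul Finset.univ k
    (fun i => (hB.pairing (t i) (hmem i)).isSchwartzLimit)
  have hexp := hlim.integral_exp hμ
  rw [integral_sum_indicator_sq _ _ _ fun i => (hmem i).1] at hexp
  have hX : ∀ ω, l * (brownianBridge a b T B t₁ ω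
      - brownianBridge a b T B s₁ ω + (brownianBridge a b T B t₂ ω
      - brownianBridge a b T B s₂ ω)) = l * ((b - a) * (g / T)) + ∑ i, k i * B (t i) ω := by
    intro ω
    simp only [Fin.sum_univ_five, ht, hk, brownianBridge, hg]
    simp
    field_simp
    ring
  have hI : ∀ ω, Complex.exp (Complex.I * ((l * (brownianBridge a b T B t₁ ω
      - brownianBridge a b T B s₁ ω + (brownianBridge a b T B t₂ ω
      - brownianBridge a b T B s₂ ω)) : ℝ) : ℂ))
      = Complex.exp (((l * ((b - a) * (g / T)) : ℝ) : ℂ) * Complex.I) *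
        Complex.exp (Complex.I * ((∑ i, k i * B (t i) ω : ℝ) : ℂ)) := by
    intro ω
    rw [hX, ← Complex.exp_add]
    push_cast
    ring_nf
  simp_rw [hI]
  rw [integral_const_mul, norm_mul, Complex.norm_exp_ofReal_mul_I, one_mul, hexp,
    ← Complex.ofReal_exp, Complex.norm_real, Real.norm_of_nonneg (Real.exp_nonneg _),
    Real.exp_le_exp]
  have hV : ∑ i, ∑ j, k i * k j * min (t i) (t j)
      = l ^ 2 * (incrementVar t₁ s₁ t₂ s₂ - g ^ 2 / T) := by
    have m : ∀ x y : ℝ, min x y = (x + y - |x - y|) / 2 := fun x y => by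
      rcases le_total x y with h | h
      · rw [min_eq_left h, abs_of_nonpos (by linarith)]; ring
      · rw [min_eq_right h, abs_of_nonneg (by linarith)]; ring
    have m1 : min t₁ T = t₁ := min_eq_left (hsub _ ht₁).2
    have m2 : min s₁ T = s₁ := min_eq_left (hsub _ hs₁).2
    have m3 : min t₂ T = t₂ := min_eq_left (hsub _ ht₂).2
    have m4 : min s₂ T = s₂ := min_eq_left (hsub _ hs₂).2
    have m1' : min T t₁ = t₁ := min_eq_right (hsub _ ht₁).2
    have m2' : min T s₁ = s₁ := min_eq_right (hsub _ hs₁).2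
    have m3' : min T t₂ = t₂ := min_eq_right (hsub _ ht₂).2
    have m4' : min T s₂ = s₂ := min_eq_right (hsub _ hs₂).2
    simp only [Fin.sum_univ_five, ht, hk]
    simp only [Matrix.cons_val, m1, m2, m3, m4, m1', m2', m3', m4', min_self]
    simp only [m, incrementVar, abs_sub_comm s₁ t₁, abs_sub_comm s₂ t₂, abs_sub_comm s₂ t₁,
      abs_sub_comm t₂ t₁, abs_sub_comm s₁ t₂, abs_sub_comm s₂ s₁, hg]
    field_simp
    ring
  rw [hV]
  have h1 : |g| ≤ incrementVar t₁ s₁ t₂ s₂ := abs_sum_le_incrementVar t₁ s₁ t₂ s₂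
  have h2 : |g| ≤ T / 2 := by
    obtain ⟨a1, a2⟩ := ht₁
    obtain ⟨b1, b2⟩ := hs₁
    obtain ⟨c1, c2⟩ := ht₂
    obtain ⟨d1, d2⟩ := hs₂
    exact abs_le.2 ⟨by linarith, by linarith⟩
  have h3 : g ^ 2 / T ≤ incrementVar t₁ s₁ t₂ s₂ / 2 := by
    rw [div_le_iff₀ hT, ← sq_abs]
    nlinarith [mul_le_mul h1 h2 (abs_nonneg g) (incrementVar_nonneg t₁ s₁ t₂ s₂)]
  nlinarith [mul_le_mul_of_nonneg_left h3 (sq_nonneg l)]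

/-- A process with continuous paths on `[0, T]` has a jointly measurable version there. -/
theorem exists_measurable_uncurry_version {Ω : Type*} [MeasurableSpace Ω] {μ : Measure Ω}
    {T : ℝ} (hT : 0 ≤ T) {B : ℝ → Ω → ℝ} (hm : ∀ t ∈ Icc 0 T, AEStronglyMeasurable (B t) μ)
    (hc : ∀ᵐ ω ∂μ, ContinuousOn (fun t => B t ω) (Icc 0 T)) :
    ∃ Y : ℝ → Ω → ℝ, Measurable (Function.uncurry Y) ∧
      ∀ᵐ ω ∂μ, ∀ t ∈ Icc 0 T, Y t ω = B t ω := by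
  set q : ℕ → ℤ → ℝ := fun n k => max 0 (min T ((k : ℝ) / ((n : ℝ) + 1))) with hq
  have hqm : ∀ n k, q n k ∈ Icc 0 T := fun n k =>
    ⟨le_max_left _ _, max_le hT (min_le_left _ _)⟩
  obtain ⟨Z, hZm, hZe⟩ : ∃ Z : ℕ → ℤ → Ω → ℝ, (∀ n k, Measurable (Z n k)) ∧
      ∀ᵐ ω ∂μ, ∀ n k, B (q n k) ω = Z n k ω := by
    refine ⟨fun n k => (hm (q n k) (hqm n k)).mk _,
      fun n k => (hm (q n k) (hqm n k)).stronglyMeasurable_mk.measurable, ?_⟩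
    rw [ae_all_iff]; intro n
    rw [ae_all_iff]; intro k
    exact (hm (q n k) (hqm n k)).ae_eq_mk
  have hA : ∀ n : ℕ, Measurable (fun p : ℝ × Ω => Z n ⌊p.1 * ((n : ℝ) + 1)⌋ p.2) := by
    intro n
    have h1 : Measurable (fun p : ℤ × Ω => Z n p.1 p.2) :=
      measurable_from_prod_countable_right fun k => hZm n k
    have h2 : Measurable (fun p : ℝ × Ω => (⌊p.1 * ((n : ℝ) + 1)⌋, p.2)) :=
      (Int.measurable_floor.comp (measurable_fst.mul_const _)).prodMk measurable_snd
    exact h1.comp h2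
  have hL := Measurable.limsup hA
  refine ⟨fun t ω => limsup (fun n : ℕ => Z n ⌊t * ((n : ℝ) + 1)⌋ ω) atTop, hL, ?_⟩
  filter_upwards [hc, hZe] with ω h1 h2 t ht
  refine Tendsto.limsup_eq ?_
  have h3 : Tendsto (fun n : ℕ => q n ⌊t * ((n : ℝ) + 1)⌋) atTop (𝓝 t) := by
    have h7 : Tendsto (fun n : ℕ => t - 1 / ((n : ℝ) + 1)) atTop (𝓝 t) := by
      simpa using tendsto_one_div_add_atTop_nhds_zero_nat.const_sub t
    have h4 : Tendsto (fun n : ℕ => (⌊t * ((n : ℝ) + 1)⌋ : ℝ) / ((n : ℝ) + 1)) atTop (𝓝 t) := by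
      refine tendsto_of_tendsto_of_tendsto_of_le_of_le h7 tendsto_const_nhds (fun n => ?_)
        fun n => ?_
      · have hn : (0 : ℝ) < (n : ℝ) + 1 := by positivity
        rw [le_div_iff₀ hn, sub_mul, one_div_mul_cancel hn.ne']
        exact (Int.sub_one_lt_floor _).le
      · have hn : (0 : ℝ) < (n : ℝ) + 1 := by positivity
        exact (div_le_iff₀ hn).2 (Int.floor_le _)
    have h5 := (tendsto_const_nhds (x := (0 : ℝ))).max ((tendsto_const_nhds (x := T)).min h4)
    rwa [min_eq_right ht.2, max_eq_right ht.1] at h5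
  have h6 := (h1 t ht).tendsto.comp (tendsto_nhdsWithin_iff.2
    ⟨h3, Eventually.of_forall fun n => hqm n _⟩)
  exact h6.congr fun n => h2 n _

theorem heatKernelReal_eq_integral {ε : ℝ} (hε : 0 < ε) (y : ℝ) :
    ((heatKernelReal ε y : ℝ) : ℂ) = ((1 / (2 * Real.pi) : ℝ) : ℂ) *
      ∫ l : ℝ, ((Real.exp (-(ε * l ^ 2 / 2)) : ℝ) : ℂ) *
        Complex.exp (Complex.I * ((l * y : ℝ) : ℂ)) := by
  have h := fourierIntegral_gaussian (b := ((ε / 2 : ℝ) : ℂ)) (by simpa using hε) (y : ℂ)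
  have h1 : ∀ l : ℝ, ((Real.exp (-(ε * l ^ 2 / 2)) : ℝ) : ℂ) *
        Complex.exp (Complex.I * ((l * y : ℝ) : ℂ))
      = Complex.exp (Complex.I * y * l) * Complex.exp (-((ε / 2 : ℝ) : ℂ) * (l : ℂ) ^ 2) := by
    intro l
    rw [Complex.ofReal_exp, mul_comm]
    push_cast
    ring_nf
  simp_rw [h1]
  rw [h]
  have h2 : ((Real.pi : ℂ) / ((ε / 2 : ℝ) : ℂ)) ^ (1 / 2 : ℂ)
      = ((√(Real.pi / (ε / 2)) : ℝ) : ℂ) := by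
    rw [Real.sqrt_eq_rpow, Complex.ofReal_cpow (by positivity)]
    push_cast
    rfl
  have h3 : Complex.exp (-(y : ℂ) ^ 2 / (4 * ((ε / 2 : ℝ) : ℂ)))
      = ((Real.exp (-(y ^ 2) / (2 * ε)) : ℝ) : ℂ) := by
    rw [Complex.ofReal_exp]
    congr 1
    push_cast
    ring
  rw [h2, h3, ← Complex.ofReal_mul, ← Complex.ofReal_mul, heatKernelReal, ← mul_assoc]
  congr 2
  have hp := Real.pi_pos
  have h4 : √(Real.pi / (ε / 2)) * √(2 * Real.pi * ε) = 2 * Real.pi := by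
    rw [← Real.sqrt_mul (by positivity), show Real.pi / (ε / 2) * (2 * Real.pi * ε)
      = (2 * Real.pi) ^ 2 by field_simp, Real.sqrt_sq (by positivity)]
  rw [div_mul_eq_mul_div, one_mul, div_eq_div_iff (by positivity) (by positivity), one_mul, h4]

theorem norm_heatKernelReal_le {ε : ℝ} (hε : 0 < ε) (y : ℝ) :
    ‖heatKernelReal ε y‖ ≤ 1 / √(2 * Real.pi * ε) := by
  rw [heatKernelReal, Real.norm_of_nonneg (by positivity)]
  refine mul_le_of_le_one_right (by positivity) (Real.exp_le_one_iff.2 ?_)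
  exact div_nonpos_of_nonpos_of_nonneg (by nlinarith [sq_nonneg y]) (by positivity)

theorem integral_triangle_eq_half {h : ℝ → ℝ → ℝ} (hm : Measurable (Function.uncurry h))
    {C : ℝ} (hC : ∀ t s, ‖h t s‖ ≤ C) (hs : ∀ t s, h t s = h s t) {T : ℝ} (hT : 0 ≤ T) :
    ∫ t in (0 : ℝ)..T, ∫ s in (0 : ℝ)..t, h t s
      = 1 / 2 * ∫ t in Ioc 0 T, ∫ s in Ioc 0 T, h t s := by
  set u : ℝ → ℝ → ℝ := fun t s => {p : ℝ × ℝ | p.2 ≤ p.1}.indicator (Function.uncurry h) (t, s)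
    with hu
  have hset : MeasurableSet {p : ℝ × ℝ | p.2 ≤ p.1} :=
    measurableSet_le measurable_snd measurable_fst
  have hum : Measurable (Function.uncurry u) := hm.indicator hset
  have hub : ∀ t s, ‖u t s‖ ≤ C := fun t s => (norm_indicator_le_norm_self _ _).trans (hC t s)
  have husec : ∀ t, ∫ s in Ioc 0 T, u t s = ∫ s in Ioc 0 T ∩ Iic t, h t s := by
    intro t
    have : (fun s => u t s) = (Iic t).indicator (h t) := by
      ext s; simp [hu, indicator, Function.uncurry]
    rw [this, setIntegral_indicator measurableSet_Iic]
  have hui : Integrable (Function.uncurry u)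
      ((volume.restrict (Ioc 0 T)).prod (volume.restrict (Ioc 0 T))) :=
    Integrable.of_bound hum.aestronglyMeasurable C (ae_of_all _ fun p => hub p.1 p.2)
  have hL : ∫ t in (0 : ℝ)..T, ∫ s in (0 : ℝ)..t, h t s
      = ∫ t in Ioc 0 T, ∫ s in Ioc 0 T, u t s := by
    rw [intervalIntegral.integral_of_le hT]
    refine setIntegral_congr_fun measurableSet_Ioc fun t ht => ?_
    rw [husec, intervalIntegral.integral_of_le ht.1.le, Ioc_inter_Iic, min_eq_right ht.2]
  have hR : ∫ t in Ioc 0 T, ∫ s in Ioc 0 T, u t s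
      = ∫ t in Ioc 0 T, ∫ s in Ioc 0 T, u s t := integral_integral_swap hui
  have hsum : ∫ t in Ioc 0 T, ∫ s in Ioc 0 T, h t s
      = (∫ t in Ioc 0 T, ∫ s in Ioc 0 T, u t s) + ∫ t in Ioc 0 T, ∫ s in Ioc 0 T, u s t := by
    refine Eq.trans ?_ (integral_add hui.integral_prod_left hui.swap.integral_prod_left)
    refine setIntegral_congr_fun measurableSet_Ioc fun t ht => ?_
    have h1 : Integrable (fun s => u t s) (volume.restrict (Ioc 0 T)) :=
      Integrable.of_bound (hum.comp measurable_prodMk_left).aestronglyMeasurable C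
        (ae_of_all _ fun s => hub t s)
    have h2 : Integrable (fun s => u s t) (volume.restrict (Ioc 0 T)) :=
      Integrable.of_bound (hum.comp measurable_prodMk_right).aestronglyMeasurable C
        (ae_of_all _ fun s => hub s t)
    rw [← integral_add h1 h2]
    refine integral_congr_ae ?_
    have hne : ∀ᵐ s ∂(volume.restrict (Ioc 0 T)), s ≠ t :=
      ae_restrict_of_ae (Measure.ae_ne volume t)
    filter_upwards [hne] with s hst
    simp only [hu, indicator, mem_ofPred_eq, Function.uncurry]
    rcases lt_or_gt_of_ne hst with hlt | hlt
    · simp [hlt.le, hlt.not_ge]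
    · simp [hlt.le, hlt.not_ge, hs t s]
  rw [hsum, hL, ← hR]
  ring

/-- The Fourier transform of the image of `ν` under the path `x`. -/
noncomputable def pathFourier (ν : Measure ℝ) (x : ℝ → ℝ) (l : ℝ) : ℂ :=
  ∫ t, Complex.exp (Complex.I * ((l * x t : ℝ) : ℂ)) ∂ν

theorem Complex.norm_exp_I_mul_ofReal' (y : ℝ) : ‖Complex.exp (Complex.I * (y : ℂ))‖ = 1 := by
  rw [mul_comm, Complex.norm_exp_ofReal_mul_I]

theorem pathFourier_mul_conj {ν : Measure ℝ} [IsFiniteMeasure ν] (x : ℝ → ℝ) (l : ℝ) :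
    ((‖pathFourier ν x l‖ ^ 2 : ℝ) : ℂ)
      = ∫ p : ℝ × ℝ, Complex.exp (Complex.I * ((l * (x p.1 - x p.2) : ℝ) : ℂ)) ∂(ν.prod ν) := by
  push_cast
  rw [← Complex.mul_conj', pathFourier, ← integral_conj, ← integral_prod_mul]
  congr 1
  ext p
  rw [← Complex.exp_conj, ← Complex.exp_add]
  congr 1
  simp
  ring

theorem integral_heatKernelReal_eq {ν : Measure ℝ} [IsFiniteMeasure ν] {x : ℝ → ℝ}
    (hx : Measurable x) {ε : ℝ} (hε : 0 < ε) :
    ∫ t, ∫ s, heatKernelReal ε (x t - x s) ∂ν ∂ν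
      = 1 / (2 * Real.pi) * ∫ l : ℝ, Real.exp (-(ε * l ^ 2 / 2)) * ‖pathFourier ν x l‖ ^ 2 := by
  have hk : Measurable (heatKernelReal ε) := by
    unfold heatKernelReal; fun_prop
  have hkb : ∀ y, ‖heatKernelReal ε y‖ ≤ 1 / √(2 * Real.pi * ε) := norm_heatKernelReal_le hε
  have hpm : Measurable (fun p : ℝ × ℝ => x p.1 - x p.2) :=
    (hx.comp measurable_fst).sub (hx.comp measurable_snd)
  have hi : Integrable (fun p : ℝ × ℝ => heatKernelReal ε (x p.1 - x p.2)) (ν.prod ν) :=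
    Integrable.of_bound (hk.comp hpm).aestronglyMeasurable _ (ae_of_all _ fun p => hkb _)
  rw [← integral_prod _ hi]
  have hg : Integrable (fun l : ℝ => Real.exp (-(ε * l ^ 2 / 2))) := by
    have := integrable_exp_neg_mul_sq (b := ε / 2) (by positivity)
    refine this.congr (ae_of_all _ fun l => ?_)
    simp only
    congr 1; ring
  apply Complex.ofReal_injective
  rw [← integral_complex_ofReal, Complex.ofReal_mul, ← integral_complex_ofReal]
  simp_rw [Complex.ofReal_mul, pathFourier_mul_conj]
  simp_rw [heatKernelReal_eq_integral hε]
  rw [integral_const_mul]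
  congr 1
  rw [integral_integral_swap]
  · simp_rw [integral_const_mul]
  · refine Integrable.mono' (g := fun q : (ℝ × ℝ) × ℝ => (1 : ℝ) * Real.exp (-(ε * q.2 ^ 2 / 2)))
      ((integrable_const (1 : ℝ)).mul_prod hg) ?_ ?_
    · refine Measurable.aestronglyMeasurable ?_
      have h1 : Measurable (fun q : (ℝ × ℝ) × ℝ => x q.1.1 - x q.1.2) := hpm.comp measurable_fst
      simp only [Function.uncurry_def]
      fun_prop
    · refine ae_of_all _ fun q => ?_
      simp only [Function.uncurry]
      rw [norm_mul, Complex.norm_exp_I_mul_ofReal', Complex.norm_real,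
        Real.norm_of_nonneg (Real.exp_nonneg _), mul_one, one_mul]

theorem measurable_pathFourier {Ω : Type*} [MeasurableSpace Ω] {X : ℝ → Ω → ℝ}
    (hX : Measurable (Function.uncurry X)) (ν : Measure ℝ) [SFinite ν] :
    Measurable (fun p : ℝ × Ω => pathFourier ν (fun t => X t p.2) p.1) := by
  have h1 : Measurable (fun q : (ℝ × Ω) × ℝ => X q.2 q.1.2) :=
    hX.comp (measurable_snd.prodMk (measurable_snd.comp measurable_fst))
  have h : StronglyMeasurable (Function.uncurry fun (p : ℝ × Ω) (t : ℝ) =>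
      Complex.exp (Complex.I * ((p.1 * X t p.2 : ℝ) : ℂ))) := by
    refine Measurable.stronglyMeasurable ?_
    simp only [Function.uncurry_def]
    fun_prop
  exact h.integral_prod_right.measurable

theorem norm_pathFourier_le {ν : Measure ℝ} [IsFiniteMeasure ν] (x : ℝ → ℝ) (l : ℝ) :
    ‖pathFourier ν x l‖ ≤ ν.real univ := by
  have := norm_integral_le_of_norm_le_const (μ := ν)
    (ae_of_all _ fun t => (Complex.norm_exp_I_mul_ofReal' (l * x t)).le)
  simpa [pathFourier] using this

/-- The fourth moment of the Fourier transform of the occupation measure is bounded by the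
characteristic functions of the sums of two increments. -/
theorem lintegral_norm_pathFourier_pow_four_le {Ω : Type*} [MeasurableSpace Ω] {P : Measure Ω}
    [IsFiniteMeasure P] {X : ℝ → Ω → ℝ} (hX : Measurable (Function.uncurry X)) (ν : Measure ℝ)
    [IsFiniteMeasure ν] (l : ℝ) :
    ∫⁻ ω, ENNReal.ofReal (‖pathFourier ν (fun t => X t ω) l‖ ^ 4) ∂P
      ≤ ∫⁻ t₁, ∫⁻ s₁, ∫⁻ t₂, ∫⁻ s₂, ‖∫ ω, Complex.exp (Complex.I *
        ((l * (X t₁ ω - X s₁ ω + (X t₂ ω - X s₂ ω)) : ℝ) : ℂ)) ∂P‖ₑ ∂ν ∂ν ∂ν ∂ν := by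
  set F : Ω → (ℝ × ℝ) × (ℝ × ℝ) → ℂ := fun ω q => Complex.exp (Complex.I *
        ((l * (X q.1.1 ω - X q.1.2 ω + (X q.2.1 ω - X q.2.2 ω)) : ℝ) : ℂ)) with hF
  have hFm : Measurable (Function.uncurry F) := by
    have h1 : Measurable (fun q : Ω × ((ℝ × ℝ) × (ℝ × ℝ)) => X q.2.1.1 q.1) :=
      hX.comp (by fun_prop : Measurable fun q : Ω × ((ℝ × ℝ) × (ℝ × ℝ)) => (q.2.1.1, q.1))
    have h2 : Measurable (fun q : Ω × ((ℝ × ℝ) × (ℝ × ℝ)) => X q.2.1.2 q.1) :=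
      hX.comp (by fun_prop : Measurable fun q : Ω × ((ℝ × ℝ) × (ℝ × ℝ)) => (q.2.1.2, q.1))
    have h3 : Measurable (fun q : Ω × ((ℝ × ℝ) × (ℝ × ℝ)) => X q.2.2.1 q.1) :=
      hX.comp (by fun_prop : Measurable fun q : Ω × ((ℝ × ℝ) × (ℝ × ℝ)) => (q.2.2.1, q.1))
    have h4 : Measurable (fun q : Ω × ((ℝ × ℝ) × (ℝ × ℝ)) => X q.2.2.2 q.1) :=
      hX.comp (by fun_prop : Measurable fun q : Ω × ((ℝ × ℝ) × (ℝ × ℝ)) => (q.2.2.2, q.1))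
    simp only [Function.uncurry_def, hF]
    fun_prop
  have hpow : ∀ ω, ((‖pathFourier ν (fun t => X t ω) l‖ ^ 4 : ℝ) : ℂ)
      = ∫ q, F ω q ∂((ν.prod ν).prod (ν.prod ν)) := by
    intro ω
    have : ‖pathFourier ν (fun t => X t ω) l‖ ^ 4 = ‖pathFourier ν (fun t => X t ω) l‖ ^ 2 *
      ‖pathFourier ν (fun t => X t ω) l‖ ^ 2 := by ring
    rw [this, Complex.ofReal_mul, pathFourier_mul_conj, ← integral_prod_mul]
    congr 1
    ext q
    rw [hF, ← Complex.exp_add]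
    congr 1
    push_cast
    ring
  have hm4 : Measurable (fun ω => ‖pathFourier ν (fun t => X t ω) l‖ ^ 4) :=
    ((measurable_pathFourier hX ν).comp measurable_prodMk_left).norm.pow_const 4
  have hi4 : Integrable (fun ω => ‖pathFourier ν (fun t => X t ω) l‖ ^ 4) P := by
    refine Integrable.of_bound hm4.aestronglyMeasurable (ν.real univ ^ 4) (ae_of_all _ fun ω => ?_)
    rw [Real.norm_of_nonneg (by positivity)]
    exact pow_le_pow_left₀ (norm_nonneg _) (norm_pathFourier_le _ _) 4
  rw [← ofReal_integral_eq_lintegral_ofReal hi4 (ae_of_all _ fun ω => by positivity)]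
  have hswap : ((∫ ω, ‖pathFourier ν (fun t => X t ω) l‖ ^ 4 ∂P : ℝ) : ℂ)
      = ∫ q, ∫ ω, F ω q ∂P ∂((ν.prod ν).prod (ν.prod ν)) := by
    rw [← integral_complex_ofReal]
    simp_rw [hpow]
    refine integral_integral_swap (Integrable.of_bound hFm.aestronglyMeasurable 1
      (ae_of_all _ fun q => ?_))
    simp only [Function.uncurry_def, hF]
    exact (Complex.norm_exp_I_mul_ofReal' _).le
  have hle : ENNReal.ofReal (∫ ω, ‖pathFourier ν (fun t => X t ω) l‖ ^ 4 ∂P)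
      = ‖((∫ ω, ‖pathFourier ν (fun t => X t ω) l‖ ^ 4 ∂P : ℝ) : ℂ)‖ₑ := by
    rw [← ofReal_norm, Complex.norm_real, Real.norm_of_nonneg]
    exact integral_nonneg fun ω => by positivity
  rw [hle, hswap]
  refine (enorm_integral_le_lintegral_enorm _).trans ?_
  refine (lintegral_prod_le _).trans ?_
  refine (lintegral_prod_le _).trans ?_
  exact lintegral_mono fun t₁ => lintegral_mono fun s₁ => lintegral_prod_le _

theorem lintegral_exp_neg_mul_abs_le {c d : ℝ} (hcd : c ≤ d) (l x : ℝ) :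
    ∫⁻ y in Ioc c d, ENNReal.ofReal (Real.exp (-(l ^ 2 / 4 * |x - y|)))
      ≤ ENNReal.ofReal ((d - c + 8) / (1 + l ^ 2)) := by
  have h1 : ∫⁻ y in Ioc c d, ENNReal.ofReal (Real.exp (-(l ^ 2 / 4 * |x - y|)))
      ≤ ENNReal.ofReal (d - c) := by
    refine (lintegral_mono (g := fun _ => 1) fun y => ?_).trans ?_
    · rw [← ENNReal.ofReal_one]
      refine ENNReal.ofReal_le_ofReal (Real.exp_le_one_iff.2 ?_)
      have := abs_nonneg (x - y)
      nlinarith [mul_nonneg (sq_nonneg l) this]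
    · simp
  have h2 : ENNReal.ofReal (l ^ 2) * ∫⁻ y in Ioc c d,
      ENNReal.ofReal (Real.exp (-(l ^ 2 / 4 * |x - y|))) ≤ ENNReal.ofReal 8 := by
    rcases eq_or_ne l 0 with rfl | hl
    · simp
    have hl2 : 0 < l ^ 2 := by positivity
    have hval : ∫ y : ℝ, Real.exp (-(l ^ 2 / 4) * |y|) = 8 / l ^ 2 := by
      rw [integral_comp_abs (f := fun y => Real.exp (-(l ^ 2 / 4) * y)),
        integral_exp_mul_Ioi (by linarith)]
      simp
      field_simp
      norm_num
    have habs : Integrable (fun y : ℝ => Real.exp (-(l ^ 2 / 4) * |y|)) := by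
      refine Integrable.of_integral_ne_zero ?_
      rw [hval]
      positivity
    have h3 : ∫⁻ y in Ioc c d, ENNReal.ofReal (Real.exp (-(l ^ 2 / 4 * |x - y|)))
        ≤ ENNReal.ofReal (8 / l ^ 2) := by
      refine (setLIntegral_le_lintegral _ _).trans ?_
      rw [← hval, ofReal_integral_eq_lintegral_ofReal habs (ae_of_all _ fun y => Real.exp_nonneg _)]
      rw [← lintegral_sub_left_eq_self _ x]
      simp [neg_mul]
    refine (mul_le_mul_right h3 _).trans ?_
    rw [← ENNReal.ofReal_mul hl2.le, mul_div_cancel₀ _ hl2.ne']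
  have hp : 0 < 1 + l ^ 2 := by positivity
  rw [ENNReal.ofReal_div_of_pos hp, ENNReal.le_div_iff_mul_le (Or.inl (by simpa using hp))
    (Or.inl ENNReal.ofReal_ne_top), mul_comm, ENNReal.ofReal_add zero_le_one (sq_nonneg l),
    ENNReal.ofReal_one, add_mul, one_mul, ENNReal.ofReal_add (by linarith) (by norm_num)]
  exact add_le_add h1 h2

theorem lintegral_pairing_le {α : Type*} [MeasurableSpace α] {ν : Measure α} [SFinite ν]
    {k : α → α → ℝ≥0∞} (hk : Measurable (Function.uncurry k)) {M : ℝ≥0∞}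
    (hM : ∀ x, ∫⁻ y, k x y ∂ν ≤ M) (hs : ∀ x y, k x y = k y x) :
    ∫⁻ t₁, ∫⁻ s₁, ∫⁻ t₂, ∫⁻ s₂, (k t₁ s₁ * k t₂ s₂ + k t₁ s₂ * k t₂ s₁ + k t₁ t₂ * k s₁ s₂)
      ∂ν ∂ν ∂ν ∂ν ≤ 3 * (M ^ 2 * ν univ ^ 2) := by
  have hkl : ∀ x, Measurable (fun y => k x y) := fun x => hk.comp measurable_prodMk_left
  have hkr : ∀ x, Measurable (fun y => k y x) := fun x => hk.comp measurable_prodMk_right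
  have h1 : ∀ t₁ s₁ t₂, ∫⁻ s₂, (k t₁ s₁ * k t₂ s₂ + k t₁ s₂ * k t₂ s₁ + k t₁ t₂ * k s₁ s₂) ∂ν
      ≤ M * (k t₁ s₁ + k t₂ s₁ + k t₁ t₂) := by
    intro t₁ s₁ t₂
    rw [lintegral_add_left (by fun_prop), lintegral_add_left (by fun_prop),
      lintegral_const_mul _ (by fun_prop), lintegral_mul_const _ (by fun_prop),
      lintegral_const_mul _ (by fun_prop), mul_add, mul_add, mul_comm M, mul_comm M (k t₁ t₂)]
    gcongr <;> apply hM
  have h2 : ∀ t₁ s₁, ∫⁻ t₂, M * (k t₁ s₁ + k t₂ s₁ + k t₁ t₂) ∂ν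
      ≤ M * (k t₁ s₁ * ν univ + M + M) := by
    intro t₁ s₁
    rw [lintegral_const_mul _ (by fun_prop), lintegral_add_left (by fun_prop),
      lintegral_add_left (by fun_prop), lintegral_const]
    gcongr
    · simp_rw [hs _ s₁]; exact hM _
    · exact hM _
  have h3 : ∀ t₁, ∫⁻ s₁, M * (k t₁ s₁ * ν univ + M + M) ∂ν ≤ 3 * (M ^ 2 * ν univ) := by
    intro t₁
    rw [lintegral_const_mul _ (by fun_prop), lintegral_add_left (by fun_prop),
      lintegral_add_left (by fun_prop), lintegral_const, lintegral_mul_const _ (by fun_prop)]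
    calc _ ≤ M * (M * ν univ + M * ν univ + M * ν univ) := by gcongr; exact hM _
      _ = _ := by ring
  calc _ ≤ ∫⁻ t₁, ∫⁻ s₁, ∫⁻ t₂, M * (k t₁ s₁ + k t₂ s₁ + k t₁ t₂) ∂ν ∂ν ∂ν :=
        lintegral_mono fun t₁ => lintegral_mono fun s₁ => lintegral_mono fun t₂ => h1 _ _ _
    _ ≤ ∫⁻ t₁, ∫⁻ s₁, M * (k t₁ s₁ * ν univ + M + M) ∂ν ∂ν :=
        lintegral_mono fun t₁ => lintegral_mono fun s₁ => h2 _ _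
    _ ≤ ∫⁻ t₁, 3 * (M ^ 2 * ν univ) ∂ν := lintegral_mono fun t₁ => h3 _
    _ = _ := by rw [lintegral_const]; ring

theorem lintegral_norm_pathFourier_pow_four_le_of_charFun {Ω : Type*} [MeasurableSpace Ω]
    {P : Measure Ω} [IsFiniteMeasure P] {X : ℝ → Ω → ℝ} (hX : Measurable (Function.uncurry X))
    {c d : ℝ} (hcd : c ≤ d) (l : ℝ)
    (h : ∀ t₁ ∈ Icc c d, ∀ s₁ ∈ Icc c d, ∀ t₂ ∈ Icc c d, ∀ s₂ ∈ Icc c d,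
      ‖∫ ω, Complex.exp (Complex.I *
        ((l * (X t₁ ω - X s₁ ω + (X t₂ ω - X s₂ ω)) : ℝ) : ℂ)) ∂P‖
        ≤ Real.exp (-(l ^ 2 / 4 * incrementVar t₁ s₁ t₂ s₂))) :
    ∫⁻ ω, ENNReal.ofReal (‖pathFourier (volume.restrict (Ioc c d)) (fun t => X t ω) l‖ ^ 4) ∂P
      ≤ ENNReal.ofReal (3 * ((d - c + 8) * (d - c)) ^ 2 / (1 + l ^ 2) ^ 2) := by
  refine (lintegral_norm_pathFourier_pow_four_le hX _ l).trans ?_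
  set k : ℝ → ℝ → ℝ≥0∞ := fun x y => ENNReal.ofReal (Real.exp (-(l ^ 2 / 4 * |x - y|))) with hk
  have hkm : Measurable (Function.uncurry k) := by
    simp only [Function.uncurry_def, hk]
    fun_prop
  have hpair := lintegral_pairing_le (ν := volume.restrict (Ioc c d)) hkm
    (lintegral_exp_neg_mul_abs_le hcd l) (fun x y => by simp only [hk, abs_sub_comm])
  have hprod : ∀ {x y z w v : ℝ}, |x - y| + |z - w| ≤ v →
      ENNReal.ofReal (Real.exp (-(l ^ 2 / 4 * v))) ≤ k x y * k z w := by
    intro x y z w v hv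
    rw [← ENNReal.ofReal_mul (Real.exp_nonneg _), ← Real.exp_add]
    refine ENNReal.ofReal_le_ofReal (Real.exp_le_exp.2 ?_)
    nlinarith [mul_le_mul_of_nonneg_left hv (sq_nonneg l)]
  refine le_trans ?_ (hpair.trans (le_of_eq ?_))
  · refine setLIntegral_mono' measurableSet_Ioc fun t₁ ht₁ => ?_
    refine setLIntegral_mono' measurableSet_Ioc fun s₁ hs₁ => ?_
    refine setLIntegral_mono' measurableSet_Ioc fun t₂ ht₂ => ?_
    refine setLIntegral_mono' measurableSet_Ioc fun s₂ hs₂ => ?_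
    rw [← ofReal_norm]
    refine (ENNReal.ofReal_le_ofReal (h t₁ (Ioc_subset_Icc_self ht₁) s₁ (Ioc_subset_Icc_self hs₁)
      t₂ (Ioc_subset_Icc_self ht₂) s₂ (Ioc_subset_Icc_self hs₂))).trans ?_
    rcases min_pairing_le_incrementVar t₁ s₁ t₂ s₂ with h1 | h1 | h1
    · exact (hprod h1).trans (le_add_right le_self_add)
    · exact (hprod h1).trans (le_add_right le_add_self)
    · exact (hprod h1).trans le_add_self
  · rw [Measure.restrict_apply_univ, Real.volume_Ioc, ← ENNReal.ofReal_pow (by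
      have : 0 ≤ d - c := by linarith
      positivity), ← ENNReal.ofReal_pow (by linarith), ← ENNReal.ofReal_mul (by positivity),
      show (3 : ℝ≥0∞) = ENNReal.ofReal 3 by simp, ← ENNReal.ofReal_mul (by norm_num)]
    congr 1
    have : 1 + l ^ 2 ≠ 0 := by positivity
    field_simp

theorem pathFourier_restrict_add {x : ℝ → ℝ} (hx : Measurable x) (l : ℝ) {a b c : ℝ}
    (hab : a ≤ b) (hbc : b ≤ c) :
    pathFourier (volume.restrict (Ioc a c)) x l = pathFourier (volume.restrict (Ioc a b)) x l
      + pathFourier (volume.restrict (Ioc b c)) x l := by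
  have hi : ∀ u v : ℝ, IntegrableOn (fun t => Complex.exp (Complex.I * ((l * x t : ℝ) : ℂ)))
      (Ioc u v) := fun u v =>
    Measure.integrableOn_of_bounded (M := 1) (by simp)
      (by fun_prop : Measurable _).aestronglyMeasurable
      (ae_of_all _ fun t => (Complex.norm_exp_I_mul_ofReal' _).le)
  rw [pathFourier, ← Ioc_union_Ioc_eq_Ioc hab hbc, setIntegral_union
    (Ioc_disjoint_Ioc_of_le le_rfl) measurableSet_Ioc (hi _ _) (hi _ _)]
  rfl

theorem norm_add_pow_four_le (z w : ℂ) : ‖z + w‖ ^ 4 ≤ 8 * (‖z‖ ^ 4 + ‖w‖ ^ 4) :=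
  (pow_le_pow_left₀ (norm_nonneg _) (norm_add_le z w) 4).trans
    ((add_pow_le (norm_nonneg z) (norm_nonneg w) 4).trans (by norm_num))

theorem sq_lintegral_le_pi_mul {g : ℝ → ℝ≥0∞} (hg : Measurable g) :
    (∫⁻ l, g l) ^ 2 ≤ ENNReal.ofReal Real.pi * ∫⁻ l, ENNReal.ofReal (1 + l ^ 2) * g l ^ 2 := by
  have hh := ENNReal.lintegral_mul_le_Lp_mul_Lq (volume : Measure ℝ) Real.HolderConjugate.two_two
    (f := fun l => ENNReal.ofReal (√(1 + l ^ 2))⁻¹)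
    (g := fun l => ENNReal.ofReal (√(1 + l ^ 2)) * g l) (by fun_prop) (by fun_prop)
  have hp : ∀ l : ℝ, 0 < 1 + l ^ 2 := fun l => by positivity
  have e1 : ∀ l : ℝ, ((fun l => ENNReal.ofReal (√(1 + l ^ 2))⁻¹) *
      (fun l => ENNReal.ofReal (√(1 + l ^ 2)) * g l)) l = g l := by
    intro l
    rw [Pi.mul_apply, ← mul_assoc, ← ENNReal.ofReal_mul (by positivity),
      inv_mul_cancel₀ (Real.sqrt_pos.2 (hp l)).ne', ENNReal.ofReal_one, one_mul]
  have e2 : ∀ l : ℝ, ENNReal.ofReal (√(1 + l ^ 2))⁻¹ ^ (2 : ℝ)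
      = ENNReal.ofReal (1 + l ^ 2)⁻¹ := by
    intro l
    rw [ENNReal.rpow_two, ← ENNReal.ofReal_pow (by positivity), inv_pow, Real.sq_sqrt (hp l).le]
  have e3 : ∀ l : ℝ, (ENNReal.ofReal (√(1 + l ^ 2)) * g l) ^ (2 : ℝ)
      = ENNReal.ofReal (1 + l ^ 2) * g l ^ 2 := by
    intro l
    rw [ENNReal.rpow_two, mul_pow, ← ENNReal.ofReal_pow (by positivity), Real.sq_sqrt (hp l).le]
  simp_rw [e1, e2, e3] at hh
  rw [← ofReal_integral_eq_lintegral_ofReal integrable_inv_one_add_sq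
    (ae_of_all _ fun l => (inv_pos.2 (hp l)).le), integral_univ_inv_one_add_sq] at hh
  refine (pow_le_pow_left' hh 2).trans (le_of_eq ?_)
  rw [mul_pow, ← ENNReal.rpow_two, ← ENNReal.rpow_two, ← ENNReal.rpow_mul, ← ENNReal.rpow_mul]
  norm_num

theorem lintegral_sq_lintegral_lt_top {Ω : Type*} [MeasurableSpace Ω] {P : Measure Ω} [SFinite P]
    {f : ℝ → Ω → ℝ} (hf : Measurable (Function.uncurry f)) (hf0 : ∀ l ω, 0 ≤ f l ω) {K : ℝ}
    (hK : ∀ l, ∫⁻ ω, ENNReal.ofReal (f l ω ^ 2) ∂P ≤ ENNReal.ofReal (K / (1 + l ^ 2) ^ 2)) :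
    ∫⁻ ω, (∫⁻ l, ENNReal.ofReal (f l ω)) ^ 2 ∂P < ∞ := by
  have hp : ∀ l : ℝ, 0 < 1 + l ^ 2 := fun l => by positivity
  have hfl : ∀ ω, Measurable fun l => f l ω := fun ω => hf.comp measurable_prodMk_right
  have hfr : ∀ l, Measurable fun ω => f l ω := fun l => hf.comp measurable_prodMk_left
  have hf' : Measurable fun q : Ω × ℝ => f q.2 q.1 := hf.comp measurable_swap
  calc ∫⁻ ω, (∫⁻ l, ENNReal.ofReal (f l ω)) ^ 2 ∂P
      ≤ ∫⁻ ω, ENNReal.ofReal Real.pi *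
          (∫⁻ l, ENNReal.ofReal (1 + l ^ 2) * ENNReal.ofReal (f l ω) ^ 2) ∂P :=
        lintegral_mono fun ω => sq_lintegral_le_pi_mul (hfl ω).ennreal_ofReal
    _ = ENNReal.ofReal Real.pi * ∫⁻ ω,
          (∫⁻ l, ENNReal.ofReal (1 + l ^ 2) * ENNReal.ofReal (f l ω) ^ 2) ∂P :=
        lintegral_const_mul' _ _ ENNReal.ofReal_ne_top
    _ = ENNReal.ofReal Real.pi * ∫⁻ l, ∫⁻ ω,
          ENNReal.ofReal (1 + l ^ 2) * ENNReal.ofReal (f l ω) ^ 2 ∂P := by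
        rw [lintegral_lintegral_swap]
        refine Measurable.aemeasurable ?_
        simp only [Function.uncurry_def]
        fun_prop
    _ ≤ ENNReal.ofReal Real.pi * ∫⁻ l, ENNReal.ofReal (K * (1 + l ^ 2)⁻¹) := by
        gcongr with l
        rw [lintegral_const_mul' _ _ ENNReal.ofReal_ne_top]
        simp_rw [← ENNReal.ofReal_pow (hf0 l _)]
        refine (mul_le_mul_right (hK l) _).trans (le_of_eq ?_)
        rw [← ENNReal.ofReal_mul (hp l).le]
        congr 1
        have := (hp l).ne'
        field_simp
    _ < ∞ := ENNReal.mul_lt_top ENNReal.ofReal_lt_top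
        (integrable_inv_one_add_sq.const_mul K).lintegral_lt_top

/-- Regularizing a nonnegative random density by `exp (-ε l² / 2)` converges in `L²`. -/
theorem tendsto_eLpNorm_integral_gaussian_mul {Ω : Type*} [MeasurableSpace Ω] {P : Measure Ω}
    [SFinite P] {f : ℝ → Ω → ℝ} (hf : Measurable (Function.uncurry f)) (hf0 : ∀ l ω, 0 ≤ f l ω)
    (hfin : ∫⁻ ω, (∫⁻ l, ENNReal.ofReal (f l ω)) ^ 2 ∂P < ∞) :
    (∀ ε : ℝ, 0 ≤ ε → MemLp (fun ω => ∫ l, Real.exp (-(ε * l ^ 2 / 2)) * f l ω) 2 P) ∧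
    Tendsto (fun ε : ℝ => eLpNorm (fun ω => (∫ l, Real.exp (-(ε * l ^ 2 / 2)) * f l ω)
      - ∫ l, f l ω) 2 P) (𝓝[>] 0) (𝓝 0) := by
  have hfl : ∀ ω, Measurable fun l => f l ω := fun ω => hf.comp measurable_prodMk_right
  have hexp1 : ∀ ε : ℝ, 0 ≤ ε → ∀ l : ℝ, Real.exp (-(ε * l ^ 2 / 2)) ≤ 1 := fun ε hε l =>
    Real.exp_le_one_iff.2 (by have := mul_nonneg hε (sq_nonneg l); linarith)
  have hmeas : ∀ ε : ℝ, Measurable (fun ω => ∫ l, Real.exp (-(ε * l ^ 2 / 2)) * f l ω) := by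
    intro ε
    have hf' : Measurable fun q : Ω × ℝ => f q.2 q.1 := hf.comp measurable_swap
    have : StronglyMeasurable (Function.uncurry fun (ω : Ω) (l : ℝ) =>
        Real.exp (-(ε * l ^ 2 / 2)) * f l ω) := by
      refine Measurable.stronglyMeasurable ?_
      simp only [Function.uncurry_def]
      fun_prop
    exact this.integral_prod_right.measurable
  have hbound : ∀ ε : ℝ, 0 ≤ ε → ∀ ω, ‖∫ l, Real.exp (-(ε * l ^ 2 / 2)) * f l ω‖ₑ
      ≤ ∫⁻ l, ENNReal.ofReal (f l ω) := by
    intro ε hε ω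
    refine (enorm_integral_le_lintegral_enorm _).trans (lintegral_mono fun l => ?_)
    rw [← ofReal_norm, Real.norm_of_nonneg (mul_nonneg (Real.exp_nonneg _) (hf0 l ω))]
    exact ENNReal.ofReal_le_ofReal (mul_le_of_le_one_left (hf0 l ω) (hexp1 ε hε l))
  have hmem : ∀ ε : ℝ, 0 ≤ ε → MemLp (fun ω => ∫ l, Real.exp (-(ε * l ^ 2 / 2)) * f l ω) 2 P := by
    intro ε hε
    refine ⟨(hmeas ε).aestronglyMeasurable, ?_⟩
    rw [eLpNorm_lt_top_iff_lintegral_rpow_enorm_lt_top (by norm_num) (by norm_num)]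
    refine lt_of_le_of_lt (lintegral_mono fun ω => ?_) hfin
    simp only [ENNReal.toReal_ofNat, ENNReal.rpow_two]
    exact pow_le_pow_left' (hbound ε hε ω) 2
  refine ⟨hmem, ?_⟩
  have h0 : MemLp (fun ω => ∫ l, f l ω) 2 P := by simpa using hmem 0 le_rfl
  have hSm : Measurable fun ω => ∫⁻ l, ENNReal.ofReal (f l ω) := by
    have hf' : Measurable fun q : Ω × ℝ => f q.2 q.1 := hf.comp measurable_swap
    exact Measurable.lintegral_prod_right' (f := fun q : Ω × ℝ => ENNReal.ofReal (f q.2 q.1))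
      hf'.ennreal_ofReal
  have hint : ∀ᵐ ω ∂P, Integrable (fun l => f l ω) := by
    filter_upwards [ae_lt_top (hSm.pow_const 2) hfin.ne] with ω hω
    refine ⟨(hfl ω).aestronglyMeasurable, ?_⟩
    rw [hasFiniteIntegral_iff_ofReal (ae_of_all _ fun l => hf0 l ω)]
    by_contra hc
    rw [not_lt, top_le_iff] at hc
    rw [hc] at hω
    simp at hω
  have hlim : Tendsto (fun ε : ℝ => ∫⁻ ω, ‖(∫ l, Real.exp (-(ε * l ^ 2 / 2)) * f l ω)
      - ∫ l, f l ω‖ₑ ^ (2 : ℝ) ∂P) (𝓝[>] 0) (𝓝 (∫⁻ _, 0 ∂P)) := by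
    refine tendsto_lintegral_filter_of_dominated_convergence
      (fun ω => (2 * ∫⁻ l, ENNReal.ofReal (f l ω)) ^ 2) ?_ ?_ ?_ ?_
    · refine Eventually.of_forall fun ε => ?_
      have := hmeas 0
      simp only [zero_mul, zero_div, neg_zero, Real.exp_zero, one_mul] at this
      exact (((hmeas ε).sub this).enorm).pow_const _
    · filter_upwards [self_mem_nhdsWithin] with ε hε
      refine ae_of_all _ fun ω => ?_
      rw [ENNReal.rpow_two]
      refine pow_le_pow_left' ((enorm_sub_le).trans ?_) 2
      rw [two_mul]
      refine add_le_add (hbound ε (le_of_lt hε) ω) ?_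
      simpa using hbound 0 le_rfl ω
    · simp_rw [mul_pow]
      rw [lintegral_const_mul' _ _ (by norm_num)]
      exact ENNReal.mul_ne_top (by norm_num) hfin.ne
    · filter_upwards [hint] with ω hω
      have h1 : Tendsto (fun ε : ℝ => ∫ l, Real.exp (-(ε * l ^ 2 / 2)) * f l ω) (𝓝[>] 0)
          (𝓝 (∫ l, f l ω)) := by
        refine tendsto_integral_filter_of_dominated_convergence (fun l => f l ω) ?_ ?_ hω ?_
        · refine Eventually.of_forall fun ε => Measurable.aestronglyMeasurable ?_
          have := hfl ω
          fun_prop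
        · filter_upwards [self_mem_nhdsWithin] with ε hε
          refine ae_of_all _ fun l => ?_
          rw [Real.norm_of_nonneg (mul_nonneg (Real.exp_nonneg _) (hf0 l ω))]
          exact mul_le_of_le_one_left (hf0 l ω) (hexp1 ε (le_of_lt hε) l)
        · refine ae_of_all _ fun l => ?_
          have : Continuous fun ε : ℝ => Real.exp (-(ε * l ^ 2 / 2)) * f l ω := by fun_prop
          simpa using (this.tendsto 0).mono_left nhdsWithin_le_nhds
      have h2 := (h1.sub_const (∫ l, f l ω)).enorm
      have h3 := (ENNReal.continuous_rpow_const (y := 2)).tendsto _ |>.comp h2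
      simpa [Function.comp_def] using h3
  have h4 := (ENNReal.continuous_rpow_const (y := 1 / 2)).tendsto _ |>.comp hlim
  simp only [lintegral_zero, Function.comp_def] at h4
  rw [ENNReal.zero_rpow_of_pos (by norm_num)] at h4
  refine h4.congr fun ε => ?_
  rw [eLpNorm_eq_lintegral_rpow_enorm_toReal (by norm_num) (by norm_num)]
  simp

theorem Complex.norm_exp_sub_exp_le_of_re_nonpos {u v : ℂ} (hu : u.re ≤ 0) (hv : v.re ≤ 0) :
    ‖Complex.exp u - Complex.exp v‖ ≤ ‖u - v‖ := by
  have := (convex_halfSpace_re_le 0).norm_image_sub_le_of_norm_deriv_le (f := Complex.exp)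
    (C := 1) (fun x _ => Complex.differentiableAt_exp) (fun x hx => by
      rw [Complex.deriv_exp, Complex.norm_exp]
      exact Real.exp_le_one_iff.2 hx) hv hu
  simpa using this

theorem tendsto_eLpNorm_of_le_two_of_tendsto_eLpNorm_two {Ω ι E : Type*} [MeasurableSpace Ω]
    [NormedAddCommGroup E] {P : Measure Ω} [IsProbabilityMeasure P] {L : Filter ι}
    {D : ι → Ω → E} (hD : ∀ᶠ i in L, AEStronglyMeasurable (D i) P)
    (hb : ∀ᶠ i in L, ∀ᵐ ω ∂P, ‖D i ω‖ₑ ≤ 2)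
    (h : Tendsto (fun i => eLpNorm (D i) 2 P) L (𝓝 0)) {p : ℝ≥0∞} (hp : p ≠ ∞) :
    Tendsto (fun i => eLpNorm (D i) p P) L (𝓝 0) := by
  set q : ℝ≥0∞ := max p 2 with hq
  have hqt : q ≠ ∞ := by simp [hq, hp]
  have hq2 : 2 ≤ q.toReal := by
    rw [← ENNReal.toReal_ofNat 2]
    exact ENNReal.toReal_mono hqt (le_max_right _ _)
  have hq0 : q ≠ 0 := by
    intro h0
    rw [h0] at hq2
    norm_num at hq2
  have hlim : Tendsto (fun i => (2 ^ (q.toReal - 2) * eLpNorm (D i) 2 P ^ (2 : ℝ))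
      ^ (1 / q.toReal)) L (𝓝 0) := by
    have h1 := (ENNReal.continuous_rpow_const (y := 2)).tendsto _ |>.comp h
    have h2 := ENNReal.Tendsto.const_mul (a := (2 : ℝ≥0∞) ^ (q.toReal - 2)) h1
      (Or.inr (ENNReal.rpow_ne_top_of_nonneg (by linarith) (by simp)))
    have h3 := (ENNReal.continuous_rpow_const (y := 1 / q.toReal)).tendsto _ |>.comp h2
    rw [ENNReal.zero_rpow_of_pos (by norm_num), mul_zero,
      ENNReal.zero_rpow_of_pos (by positivity)] at h3
    exact h3
  refine tendsto_of_tendsto_of_tendsto_of_le_of_le' tendsto_const_nhds hlim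
    (Eventually.of_forall fun _ => zero_le) ?_
  filter_upwards [hD, hb] with i hDi hbi
  refine (eLpNorm_le_eLpNorm_of_exponent_le (le_max_left p 2) hDi).trans ?_
  rw [← hq, eLpNorm_eq_lintegral_rpow_enorm_toReal hq0 hqt,
    eLpNorm_eq_lintegral_rpow_enorm_toReal (p := 2) (by norm_num) (by norm_num)]
  refine ENNReal.rpow_le_rpow ?_ (by positivity)
  rw [← ENNReal.rpow_mul, ENNReal.toReal_ofNat]
  norm_num
  rw [← lintegral_const_mul' _ _ (ENNReal.rpow_ne_top_of_nonneg (by linarith) (by simp))]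
  refine lintegral_mono_ae ?_
  filter_upwards [hbi] with ω hω
  calc ‖D i ω‖ₑ ^ q.toReal = ‖D i ω‖ₑ ^ (q.toReal - 2) * ‖D i ω‖ₑ ^ (2 : ℝ) := by
        rw [← ENNReal.rpow_add_of_nonneg _ _ (by linarith) (by norm_num), sub_add_cancel]
    _ ≤ _ := by
        rw [ENNReal.rpow_two]
        gcongr

theorem approxSILT_nonneg {T : ℝ} (hT : 0 ≤ T) (X : ℝ → RealTemperedDual → ℝ) (ε : ℝ)
    (ω : RealTemperedDual) : 0 ≤ approxSILT T X ε ω :=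
  intervalIntegral.integral_nonneg hT fun t ht =>
    intervalIntegral.integral_nonneg ht.1 fun s _ => by unfold heatKernelReal; positivity

theorem IsSILT.ae_nonneg {μ : Measure RealTemperedDual} {T : ℝ} (hT : 0 ≤ T)
    {X : ℝ → RealTemperedDual → ℝ} {J : RealTemperedDual → ℝ} (h : IsSILT μ T X J) :
    ∀ᵐ ω ∂μ, 0 ≤ J ω := by
  have h0 : eLpNorm (fun ω => max (-J ω) 0) 2 μ = 0 := by
    refine le_antisymm (ge_of_tendsto' h.tendsto fun ε => eLpNorm_mono fun ω => ?_) zero_le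
    have := approxSILT_nonneg hT X ε ω
    rw [Real.norm_of_nonneg (le_max_right _ _), Real.norm_eq_abs]
    refine max_le ?_ (abs_nonneg _)
    linarith [le_abs_self (approxSILT T X ε ω - J ω)]
  have hm : AEStronglyMeasurable (fun ω => max (-J ω) 0) μ :=
    (by fun_prop : Continuous fun x : ℝ => max (-x) 0).comp_aestronglyMeasurable h.memLp.1
  rw [eLpNorm_eq_zero_iff hm (by norm_num)] at h0
  filter_upwards [h0] with ω hω
  have : -J ω ≤ 0 := (le_max_left _ _).trans hω.le
  linarith

theorem IsSILT.tendsto_exp {μ : Measure RealTemperedDual} [IsProbabilityMeasure μ] {T : ℝ}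
    (hT : 0 ≤ T) {X : ℝ → RealTemperedDual → ℝ} {J : RealTemperedDual → ℝ} (h : IsSILT μ T X J)
    {z : ℂ} (hz : z.re ≤ 0) {p : ℝ≥0∞} (hp : p ≠ ∞) :
    (∀ ε : ℝ, 0 < ε → MemLp (fun ω => Complex.exp (z * (approxSILT T X ε ω : ℂ))) p μ) ∧
    MemLp (fun ω => Complex.exp (z * (J ω : ℂ))) p μ ∧
    Tendsto (fun ε : ℝ => eLpNorm (fun ω => Complex.exp (z * (approxSILT T X ε ω : ℂ))
      - Complex.exp (z * (J ω : ℂ))) p μ) (𝓝[>] 0) (𝓝 0) := by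
  have hre : ∀ x : ℝ, 0 ≤ x → (z * (x : ℂ)).re ≤ 0 := fun x hx => by
    rw [Complex.re_mul_ofReal]
    exact mul_nonpos_of_nonpos_of_nonneg hz hx
  have hle : ∀ x : ℝ, 0 ≤ x → ‖Complex.exp (z * (x : ℂ))‖ ≤ 1 := fun x hx => by
    rw [Complex.norm_exp]
    exact Real.exp_le_one_iff.2 (hre x hx)
  have hm : ∀ {Z : RealTemperedDual → ℝ}, AEStronglyMeasurable Z μ →
      AEStronglyMeasurable (fun ω => Complex.exp (z * (Z ω : ℂ))) μ := fun hZ =>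
    (by fun_prop : Continuous fun x : ℝ => Complex.exp (z * (x : ℂ))).comp_aestronglyMeasurable hZ
  have hI := approxSILT_nonneg hT X
  have hJ := h.ae_nonneg hT
  refine ⟨fun ε hε => MemLp.of_bound (hm (h.memLp_approx ε hε).1) 1
    (ae_of_all _ fun ω => hle _ (hI ε ω)), MemLp.of_bound (hm h.memLp.1) 1
    (hJ.mono fun ω hω => hle _ hω), ?_⟩
  refine tendsto_eLpNorm_of_le_two_of_tendsto_eLpNorm_two ?_ ?_ ?_ hp
  · filter_upwards [self_mem_nhdsWithin] with ε hε
    exact (hm (h.memLp_approx ε hε).1).sub (hm h.memLp.1)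
  · refine Eventually.of_forall fun ε => hJ.mono fun ω hω => ?_
    rw [← ofReal_norm, show (2 : ℝ≥0∞) = ENNReal.ofReal 2 by simp]
    refine ENNReal.ofReal_le_ofReal ((norm_sub_le _ _).trans ?_)
    linarith [hle _ (hI ε ω), hle _ hω]
  · have hlim := ENNReal.Tendsto.const_mul (a := ‖z‖ₑ) h.tendsto (Or.inr (by simp))
    rw [mul_zero] at hlim
    refine tendsto_of_tendsto_of_tendsto_of_le_of_le tendsto_const_nhds hlim
      (fun _ => zero_le) fun ε => ?_
    have hs : ‖z‖ₑ * eLpNorm (fun ω => approxSILT T X ε ω - J ω) 2 μ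
        = eLpNorm (fun ω => ‖z‖ * (approxSILT T X ε ω - J ω)) 2 μ := by
      have := eLpNorm_const_smul ‖z‖ (fun ω => approxSILT T X ε ω - J ω) 2 μ
      simpa [Pi.smul_def] using this.symm
    simp only
    rw [hs]
    refine eLpNorm_mono_ae (hJ.mono fun ω hω => ?_)
    refine (Complex.norm_exp_sub_exp_le_of_re_nonpos (hre _ (hI ε ω)) (hre _ hω)).trans ?_
    rw [← mul_sub, norm_mul, norm_mul, norm_norm, ← Complex.ofReal_sub, Complex.norm_real]

theorem approxSILT_eq_integral_pathFourier {T : ℝ} (hT : 0 ≤ T) {X : ℝ → RealTemperedDual → ℝ}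
    (hX : Measurable (Function.uncurry X)) {ε : ℝ} (hε : 0 < ε) (ω : RealTemperedDual) :
    approxSILT T X ε ω = 1 / (4 * Real.pi) * ∫ l : ℝ, Real.exp (-(ε * l ^ 2 / 2)) *
      ‖pathFourier (volume.restrict (Ioc 0 T)) (fun t => X t ω) l‖ ^ 2 := by
  have hx : Measurable fun t => X t ω := hX.comp measurable_prodMk_right
  have hm : Measurable (Function.uncurry fun t s => heatKernelReal ε (X t ω - X s ω)) := by
    simp only [Function.uncurry_def, heatKernelReal]
    fun_prop
  have hb : ∀ t s, ‖heatKernelReal ε (X t ω - X s ω)‖ ≤ 1 / √(2 * Real.pi * ε) :=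
    fun t s => norm_heatKernelReal_le hε _
  rw [approxSILT, integral_triangle_eq_half hm hb (fun t s => by
    simp only [heatKernelReal]; ring_nf) hT, integral_heatKernelReal_eq hx hε, ← mul_assoc]
  congr 1
  ring

theorem exists_isSILT_brownianBridge {μ : Measure RealTemperedDual} (hμ : IsWhiteNoiseMeasure μ)
    {T : ℝ} (hT : 0 < T) {B : ℝ → RealTemperedDual → ℝ} (hB : IsWhiteNoiseBrownianMotion μ T B)
    (a b : ℝ) : ∃ J, IsSILT μ T (brownianBridge a b T B) J := by
  have := hμ.isProbabilityMeasure
  obtain ⟨Y, hY, hYB⟩ := exists_measurable_uncurry_version hT.le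
    (fun t ht => (hB.pairing t ht).2.1.1) hB.continuous_paths
  set X : ℝ → RealTemperedDual → ℝ := brownianBridge a b T Y with hXdef
  have hX : Measurable (Function.uncurry X) := by
    have h1 : Measurable fun q : ℝ × RealTemperedDual => Y q.1 q.2 := hY
    have h2 : Measurable fun q : ℝ × RealTemperedDual => Y T q.2 :=
      h1.comp (measurable_const.prodMk measurable_snd)
    simp only [Function.uncurry_def, hXdef, brownianBridge]
    fun_prop
  have hXB : ∀ᵐ ω ∂μ, ∀ t ∈ Icc 0 T, X t ω = brownianBridge a b T B t ω := by
    filter_upwards [hYB] with ω hω t ht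
    simp only [hXdef, brownianBridge, hω t ht, hω T ⟨hT.le, le_rfl⟩]
  set f : ℝ → RealTemperedDual → ℝ := fun l ω =>
    ‖pathFourier (volume.restrict (Ioc 0 T)) (fun t => X t ω) l‖ ^ 2 with hfdef
  have hf : Measurable (Function.uncurry f) := (measurable_pathFourier hX _).norm.pow_const 2
  have hf0 : ∀ l ω, 0 ≤ f l ω := fun l ω => by positivity
  have hquarter : ∀ c d : ℝ, 0 ≤ c → d ≤ T → d - c = T / 4 → ∀ l : ℝ,
      ∫⁻ ω, ENNReal.ofReal (‖pathFourier (volume.restrict (Ioc c d)) (fun t => X t ω) l‖ ^ 4) ∂μ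
        ≤ ENNReal.ofReal (3 * ((T / 4 + 8) * (T / 4)) ^ 2 / (1 + l ^ 2) ^ 2) := by
    intro c d hc hd hcd l
    rw [← hcd]
    refine lintegral_norm_pathFourier_pow_four_le_of_charFun hX (by linarith) l ?_
    intro t₁ ht₁ s₁ hs₁ t₂ ht₂ s₂ hs₂
    refine le_of_eq_of_le ?_ (brownianBridge_norm_integral_exp_le hμ hT hB a b l hc hd hcd.le
      ht₁ hs₁ ht₂ hs₂)
    congr 1
    refine integral_congr_ae ?_
    have hsub : ∀ x ∈ Icc c d, x ∈ Icc 0 T := fun x hx => ⟨hc.trans hx.1, hx.2.trans hd⟩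
    filter_upwards [hXB] with ω hω
    rw [hω _ (hsub _ ht₁), hω _ (hsub _ hs₁), hω _ (hsub _ ht₂), hω _ (hsub _ hs₂)]
  set K : ℝ := 3 * ((T / 4 + 8) * (T / 4)) ^ 2
  clear_value K
  have hfour : ∀ l : ℝ, ∫⁻ ω, ENNReal.ofReal (f l ω ^ 2) ∂μ
      ≤ ENNReal.ofReal (256 * K / (1 + l ^ 2) ^ 2) := by
    intro l
    set ψ : ℝ → ℝ → RealTemperedDual → ℂ := fun c d ω =>
      pathFourier (volume.restrict (Ioc c d)) (fun t => X t ω) l with hψ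
    have hψm : ∀ c d, Measurable fun ω => ENNReal.ofReal (‖ψ c d ω‖ ^ 4) := fun c d =>
      (((measurable_pathFourier hX _).comp measurable_prodMk_left).norm.pow_const 4).ennreal_ofReal
    have hpt : ∀ ω, ENNReal.ofReal (f l ω ^ 2) ≤ 64 * (ENNReal.ofReal (‖ψ 0 (T / 4) ω‖ ^ 4)
        + ENNReal.ofReal (‖ψ (T / 4) (T / 2) ω‖ ^ 4)
        + ENNReal.ofReal (‖ψ (T / 2) (3 * T / 4) ω‖ ^ 4)
        + ENNReal.ofReal (‖ψ (3 * T / 4) T ω‖ ^ 4)) := by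
      intro ω
      have hx : Measurable fun t => X t ω := hX.comp measurable_prodMk_right
      rw [← ENNReal.ofReal_add (by positivity) (by positivity),
        ← ENNReal.ofReal_add (by positivity) (by positivity),
        ← ENNReal.ofReal_add (by positivity) (by positivity),
        show (64 : ℝ≥0∞) = ENNReal.ofReal 64 by simp, ← ENNReal.ofReal_mul (by norm_num)]
      refine ENNReal.ofReal_le_ofReal ?_
      have e : f l ω ^ 2 = ‖(ψ 0 (T / 4) ω + ψ (T / 4) (T / 2) ω)
          + (ψ (T / 2) (3 * T / 4) ω + ψ (3 * T / 4) T ω)‖ ^ 4 := by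
        simp only [hfdef, hψ]
        rw [← pathFourier_restrict_add hx l (by linarith) (by linarith),
          ← pathFourier_restrict_add hx l (by linarith) (by linarith),
          ← pathFourier_restrict_add hx l (by linarith) (by linarith), ← pow_mul]
      rw [e]
      linarith [norm_add_pow_four_le (ψ 0 (T / 4) ω + ψ (T / 4) (T / 2) ω)
        (ψ (T / 2) (3 * T / 4) ω + ψ (3 * T / 4) T ω),
        norm_add_pow_four_le (ψ 0 (T / 4) ω) (ψ (T / 4) (T / 2) ω),
        norm_add_pow_four_le (ψ (T / 2) (3 * T / 4) ω) (ψ (3 * T / 4) T ω)]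
    refine (lintegral_mono hpt).trans ?_
    rw [lintegral_const_mul' _ _ (by norm_num), lintegral_add_right _ (hψm _ _),
      lintegral_add_right _ (hψm _ _), lintegral_add_right _ (hψm _ _)]
    calc _ ≤ 64 * (ENNReal.ofReal (K / (1 + l ^ 2) ^ 2) + ENNReal.ofReal (K / (1 + l ^ 2) ^ 2)
          + ENNReal.ofReal (K / (1 + l ^ 2) ^ 2) + ENNReal.ofReal (K / (1 + l ^ 2) ^ 2)) := by
          gcongr
          · exact hquarter 0 (T / 4) le_rfl (by linarith) (by ring) l
          · exact hquarter (T / 4) (T / 2) (by linarith) (by linarith) (by ring) l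
          · exact hquarter (T / 2) (3 * T / 4) (by linarith) (by linarith) (by ring) l
          · exact hquarter (3 * T / 4) T (by linarith) le_rfl (by ring) l
      _ = _ := by
          rw [mul_div_assoc, ENNReal.ofReal_mul (by norm_num)]
          simp only [ENNReal.ofReal_ofNat]
          ring
  obtain ⟨hmem, hlim⟩ := tendsto_eLpNorm_integral_gaussian_mul hf hf0
    (lintegral_sq_lintegral_lt_top hf hf0 hfour)
  have happrox : ∀ ε : ℝ, 0 < ε → ∀ᵐ ω ∂μ, approxSILT T (brownianBridge a b T B) ε ω
      = 1 / (4 * Real.pi) * ∫ l : ℝ, Real.exp (-(ε * l ^ 2 / 2)) * f l ω := by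
    intro ε hε
    filter_upwards [hXB] with ω hω
    rw [← approxSILT_eq_integral_pathFourier hT.le hX hε]
    refine intervalIntegral.integral_congr fun t ht => ?_
    rw [uIcc_of_le hT.le] at ht
    refine intervalIntegral.integral_congr fun s hs => ?_
    rw [uIcc_of_le ht.1] at hs
    simp only [hω t ht, hω s ⟨hs.1, hs.2.trans ht.2⟩]
  refine ⟨fun ω => 1 / (4 * Real.pi) * ∫ l, f l ω, ?_, ?_, ?_⟩
  · intro ε hε
    exact ((hmem ε hε.le).const_mul (1 / (4 * Real.pi))).ae_eq
      ((happrox ε hε).mono fun ω hω => hω.symm)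
  · simpa using (hmem 0 le_rfl).const_mul (1 / (4 * Real.pi))
  · have h1 := ENNReal.Tendsto.const_mul (a := ‖1 / (4 * Real.pi)‖ₑ) hlim (Or.inr enorm_ne_top)
    rw [mul_zero] at h1
    refine h1.congr' ?_
    filter_upwards [self_mem_nhdsWithin] with ε hε
    rw [← eLpNorm_const_smul]
    refine eLpNorm_congr_ae ((happrox ε hε).mono fun ω hω => ?_)
    simp only [Pi.smul_apply, smul_eq_mul, hω]
    ring

theorem mainTheorem4 (μ : Measure RealTemperedDual) (hμ : IsWhiteNoiseMeasure μ)
    (T : ℝ) (hT : 0 < T) (B : ℝ → RealTemperedDual → ℝ)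
    (hB : IsWhiteNoiseBrownianMotion μ T B) (a b : ℝ) :
    (∃ J : RealTemperedDual → ℝ, IsSILT μ T (brownianBridge a b T B) J) ∧
    ∀ J : RealTemperedDual → ℝ, IsSILT μ T (brownianBridge a b T B) J →
      ∀ z : ℂ, z.re ≤ 0 → ∀ p : ℝ≥0∞, 1 ≤ p → p ≠ ∞ →
        (∀ ε : ℝ, 0 < ε → MemLp (fun ω : RealTemperedDual =>
          Complex.exp (z * (approxSILT T (brownianBridge a b T B) ε ω : ℂ))) p μ) ∧
        MemLp (fun ω : RealTemperedDual => Complex.exp (z * (J ω : ℂ))) p μ ∧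
        Tendsto (fun ε : ℝ => eLpNorm (fun ω : RealTemperedDual =>
            Complex.exp (z * (approxSILT T (brownianBridge a b T B) ε ω : ℂ))
              - Complex.exp (z * (J ω : ℂ))) p μ)
          (𝓝[>] 0) (𝓝 0) := by
  have := hμ.isProbabilityMeasure
  exact ⟨exists_isSILT_brownianBridge hμ hT hB a b,
    fun J hJ z hz p _ hp => hJ.tendsto_exp hT.le hz hp⟩
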